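/- Let $n\ge 2$ and let $(\bar g_{ij}(r))_{i,j=2,\dots,n}$ be a symmetric, positive-definite matrix of smooth functions of $r\in\mathbb{R}$. Let $\mathscr{F}_{\bar g}$ be the set of all (smooth) Riemannian metrics on $\mathbb{R}^n=\{(r,x^2,\dots,x^n)\}$ of the form $$g_R=(dr)^2+g_{ij}(r,x^2,\dots,x^n)\,dx^i dx^j,\qquad g_{ij}(r,0,\dots,0)=\bar g_{ij}(r),$$ and on $\mathbb{R}^{n+1}=\{(r,t,\tilde x^2,\dots,\tilde x^n)\}$ let $h_{PW}=2\,dr\,dt+\bar g_{ij}(r)\,d\tilde x^i d\tilde x^j$. Repeated indices are summed over $2,\dots,n$. There is a smooth matrix function $C=(C^i_j(u))_{i,j=2,\dots,n}$, $u\in\mathbb{R}$, with $$C^i_k\,\bar g_{ij}\,C^j_l=\delta_{kl},\qquad (\partial_uC^i_k)\,\bar g_{ij}\,C^j_l=C^i_k\,\bar g_{ij}\,(\partial_uC^j_l).$$ For every such $C$, the formulas $$r=u,\qquad \tilde x^i=C^i_k(u)\,x^k,\qquad t=v-\tfrac12\,\bar g_{ij}(u)\,(\partial_uC^i_k)\,C^j_l\,x^kx^l$$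 define a global change of coordinates (a diffeomorphism of $\mathbb{R}^{n+1}$) to "Brinkmann coordinates" $(v,u,x^2,\dots,x^n)$, in which $$h_{PW}=2\,dv\,du+H\,(du)^2+\sum_{i=2}^n(dx^i)^2,\qquad H(u,x^2,\dots,x^n)=-\partial_u\big(\bar g_{ij}(u)\,\partial_uC^i_k(u)\big)\,C^j_l(u)\,x^kx^l .$$ Let $\Delta H$ be the Euclidean Laplacian of $H$ with respect to $x^2,\dots,x^n$, and $H_{iju}=\partial_u\partial_{x^i}\partial_{x^j}H$. Then, where "$\neq 0$" means "not identically zero": 1. If $\partial_u(\Delta H)\neq0$, then no $g_R\in\mathscr{F}_{\bar g}$ has parallel Ricci tensor ($\nabla\mathrm{Ric}=0$ on $\mathbb{R}^n$). 2. If $\Delta H\neq0$, then no $g_R\in\mathscr{F}_{\bar g}$ is Ricci-flat. 3. If $H_{iju}\neq0$ for some $i,j\in\{2,\dots,n\}$, then no $g_R\in\mathscr{F}_{\bar g}$ is locally symmetric ($\nabla\mathrm{Rm}=0$ on $\mathbb{R}^n$). -/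

import Mathlib

open scoped ContDiff

noncomputable section

namespace PlaneWave

/-! ### Metrics and curvature in a global chart

Everything takes place on the coordinate space `ι → ℝ` with its standard global chart; a (possibly
indefinite) metric is the matrix field of its components. -/

section Curvature

variable {ι : Type*} [Fintype ι] [DecidableEq ι]

/-- The partial derivative `∂f/∂xⁱ` at the point `p`. -/
def partialD (i : ι) (f : (ι → ℝ) → ℝ) (p : ι → ℝ) : ℝ :=
  fderiv ℝ f p (Pi.single i 1)

/-- A smooth Riemannian metric on `ℝ^ι`: smooth components and a symmetric positive-definite
matrix at each point. -/
structure IsRiemannianMetric (g : (ι → ℝ) → Matrix ι ι ℝ) : Prop where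
  smooth : ∀ i j, ContDiff ℝ ∞ fun p => g p i j
  posDef : ∀ p, (g p).PosDef

/-- Christoffel symbols `Γᵏ_{ij} = ½ gᵏˡ (∂_i g_{jl} + ∂_j g_{il} - ∂_l g_{ij})` of the Levi-Civita
connection. -/
def christoffel (g : (ι → ℝ) → Matrix ι ι ℝ) (k i j : ι) (p : ι → ℝ) : ℝ :=
  (1 / 2) * ∑ l, (g p)⁻¹ k l *
    (partialD i (fun q => g q j l) p + partialD j (fun q => g q i l) p
      - partialD l (fun q => g q i j) p)

/-- Components of the curvature endomorphism: `R(∂_i, ∂_j) ∂_k = ∑_l (curvEndo g i j k l) ∂_l`, where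
`R(X, Y) Z = ∇_X ∇_Y Z - ∇_Y ∇_X Z - ∇_{[X, Y]} Z`. -/
def curvEndo (g : (ι → ℝ) → Matrix ι ι ℝ) (i j k l : ι) (p : ι → ℝ) : ℝ :=
  partialD i (christoffel g l j k) p - partialD j (christoffel g l i k) p
    + ∑ m, (christoffel g l i m p * christoffel g m j k p
      - christoffel g l j m p * christoffel g m i k p)

/-- The curvature 4-tensor `Rm_{ijkl} = g(R(∂_i, ∂_j) ∂_k, ∂_l)`. -/
def riem (g : (ι → ℝ) → Matrix ι ι ℝ) (i j k l : ι) (p : ι → ℝ) : ℝ :=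
  ∑ m, curvEndo g i j k m p * g p m l

/-- The Ricci tensor `Ric_{jk} = tr (Z ↦ R(Z, ∂_j) ∂_k)`. -/
def ricci (g : (ι → ℝ) → Matrix ι ι ℝ) (j k : ι) (p : ι → ℝ) : ℝ :=
  ∑ i, curvEndo g i j k i p

/-- The components `(∇_a Rm)_{ijkl}` of the covariant derivative of the curvature 4-tensor. -/
def covDerivRiem (g : (ι → ℝ) → Matrix ι ι ℝ) (a i j k l : ι) (p : ι → ℝ) : ℝ :=
  partialD a (riem g i j k l) p
    - ∑ m, (christoffel g m a i p * riem g m j k l p + christoffel g m a j p * riem g i m k l p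
      + christoffel g m a k p * riem g i j m l p + christoffel g m a l p * riem g i j k m p)

/-- The components `(∇_a Ric)_{jk}` of the covariant derivative of the Ricci tensor. -/
def covDerivRicci (g : (ι → ℝ) → Matrix ι ι ℝ) (a j k : ι) (p : ι → ℝ) : ℝ :=
  partialD a (ricci g j k) p
    - ∑ m, (christoffel g m a j p * ricci g m k p + christoffel g m a k p * ricci g j m p)

/-- `Ric = 0`. -/
def RicciFlat (g : (ι → ℝ) → Matrix ι ι ℝ) : Prop :=
  ∀ j k p, ricci g j k p = 0

/-- `∇ Ric = 0`. -/
def ParallelRicci (g : (ι → ℝ) → Matrix ι ι ℝ) : Prop :=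
  ∀ a j k p, covDerivRicci g a j k p = 0

/-- `∇ Rm = 0`. -/
def LocallySymmetric (g : (ι → ℝ) → Matrix ι ι ℝ) : Prop :=
  ∀ a i j k l p, covDerivRiem g a i j k l p = 0

/-- The pullback `Φ^* g` of a metric along a map between coordinate spaces. -/
def pullbackMetric (Φ : (ι → ℝ) → (ι → ℝ)) (g : (ι → ℝ) → Matrix ι ι ℝ) :
    (ι → ℝ) → Matrix ι ι ℝ := fun p => Matrix.of fun a b =>
  ∑ c, ∑ d, g (Φ p) c d * partialD a (fun q => Φ q c) p * partialD b (fun q => Φ q d) p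

/-- `Φ` is a smooth diffeomorphism of `ℝ^ι` onto itself, that is, a global change of coordinates. -/
def IsSmoothDiffeo (Φ : (ι → ℝ) → (ι → ℝ)) : Prop :=
  ContDiff ℝ ∞ Φ ∧ ∃ Ψ : (ι → ℝ) → (ι → ℝ), ContDiff ℝ ∞ Ψ ∧
    Function.LeftInverse Ψ Φ ∧ Function.RightInverse Ψ Φ

end Curvature

/-! ### Riemannian extensions, plane waves and Brinkmann coordinates

`ℝⁿ = {(r, x², …, xⁿ)}` with `n = m + 1` is `Fin 1 ⊕ Fin m → ℝ` (first `r`, then the `x`'s), and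
`ℝⁿ⁺¹` is `Fin 2 ⊕ Fin m → ℝ`, with coordinates `(r, t, x)` (Rosen) or `(v, u, x)` (Brinkmann). -/

section Wave

variable {m : ℕ}

/-- The set of all Riemannian metrics on `ℝⁿ` of the form `(dr)² + g_{ij}(r, x) dxⁱ dxʲ` such that
`g_{ij}(r, 0) = gbar_{ij}(r)`. -/
def riemannianExtensions (gbar : ℝ → Matrix (Fin m) (Fin m) ℝ) :
    Set ((Fin 1 ⊕ Fin m → ℝ) → Matrix (Fin 1 ⊕ Fin m) (Fin 1 ⊕ Fin m) ℝ) :=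
  {g | IsRiemannianMetric g ∧
    ∃ γ : (Fin 1 ⊕ Fin m → ℝ) → Matrix (Fin m) (Fin m) ℝ,
      (∀ p, g p = Matrix.fromBlocks 1 0 0 (γ p)) ∧
      ∀ r : ℝ, γ (Sum.elim (fun _ => r) (fun _ => 0)) = gbar r}

/-- The plane wave metric `2 dr dt + gbar_{ij}(r) dxⁱ dxʲ` in the coordinates `(r, t, x)`. -/
def planeWave (gbar : ℝ → Matrix (Fin m) (Fin m) ℝ) :
    (Fin 2 ⊕ Fin m → ℝ) → Matrix (Fin 2 ⊕ Fin m) (Fin 2 ⊕ Fin m) ℝ :=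
  fun p => Matrix.fromBlocks !![0, 1; 1, 0] 0 0 (gbar (p (Sum.inl 0)))

/-- The metric `2 dv du + H(u, x) (du)² + ∑ (dxⁱ)²` in the coordinates `(v, u, x)`. -/
def brinkmannMetric (H : ℝ → EuclideanSpace ℝ (Fin m) → ℝ) :
    (Fin 2 ⊕ Fin m → ℝ) → Matrix (Fin 2 ⊕ Fin m) (Fin 2 ⊕ Fin m) ℝ :=
  fun p => Matrix.fromBlocks
    !![0, 1; 1, H (p (Sum.inl 1)) (WithLp.toLp 2 fun i => p (Sum.inr i))] 0 0 1

/-- The entrywise derivative of a matrix-valued function of one variable. -/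
def matDeriv (C : ℝ → Matrix (Fin m) (Fin m) ℝ) (u : ℝ) : Matrix (Fin m) (Fin m) ℝ :=
  Matrix.of fun i k => deriv (fun s => C s i k) u

/-- The smooth matrix functions `C` that define the passage to Brinkmann coordinates:
`Cⁱ_k gbar_{ij} Cʲ_l = δ_{kl}` and `(∂_u Cⁱ_k) gbar_{ij} Cʲ_l = Cⁱ_k gbar_{ij} (∂_u Cʲ_l)`. -/
structure IsBrinkmannFrame (gbar C : ℝ → Matrix (Fin m) (Fin m) ℝ) : Prop where
  smooth : ∀ i k, ContDiff ℝ ∞ fun u => C u i k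
  orthonormal : ∀ u, (C u).transpose * gbar u * C u = 1
  symm : ∀ u, (matDeriv C u).transpose * gbar u * C u = (C u).transpose * gbar u * matDeriv C u

/-- The change of coordinates from Brinkmann coordinates `(v, u, x)` to Rosen coordinates:
`r = u`, `t = v - ½ gbar_{ij}(u) (∂_u Cⁱ_k) Cʲ_l xᵏ xˡ`, and the `i`-th transverse Rosen coordinate
is `Cⁱ_k(u) xᵏ`. -/
def brinkmannToRosen (gbar C : ℝ → Matrix (Fin m) (Fin m) ℝ) (p : Fin 2 ⊕ Fin m → ℝ) :
    Fin 2 ⊕ Fin m → ℝ :=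
  Sum.elim
    ![p (Sum.inl 1),
      p (Sum.inl 0) - (1 / 2) * ∑ i, ∑ j, ∑ k, ∑ l, gbar (p (Sum.inl 1)) i j *
        matDeriv C (p (Sum.inl 1)) i k * C (p (Sum.inl 1)) j l * p (Sum.inr k) * p (Sum.inr l)]
    (fun i => ∑ k, C (p (Sum.inl 1)) i k * p (Sum.inr k))

/-- The profile `H(u, x) = -∂_u (gbar_{ij}(u) ∂_u Cⁱ_k(u)) Cʲ_l(u) xᵏ xˡ`. -/
def profile (gbar C : ℝ → Matrix (Fin m) (Fin m) ℝ) (u : ℝ) (x : EuclideanSpace ℝ (Fin m)) : ℝ :=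
  -∑ j, ∑ k, ∑ l, deriv (fun s => ∑ i, gbar s i j * matDeriv C s i k) u * C u j l * x k * x l

/-- The second partial derivative `H_{ij} = ∂²H/∂xⁱ∂xʲ` at `(u, x)`. -/
def spatialHessian (H : ℝ → EuclideanSpace ℝ (Fin m) → ℝ) (i j : Fin m) (u : ℝ)
    (x : EuclideanSpace ℝ (Fin m)) : ℝ :=
  iteratedFDeriv ℝ 2 (H u) x ![EuclideanSpace.single i 1, EuclideanSpace.single j 1]

end Wave

end PlaneWave

end

/-! The two conditions on `C` say that its columns form a parallel orthonormal frame along the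
`r`-axis. Write ḡ for `gbar` and S = ½ ḡ⁻¹ḡ'. Differentiating CᵀḡC = 1 and using the symmetry
condition gives C' = -SC (`IsBrinkmannFrame.matDeriv_eq`). Conversely, solving this linear equation
globally from an orthonormal initial value yields a frame. Substituted into the profile, it gives H
= -xᵀNx with N = CᵀḡKC, where K = -(S' + S²) is the Jacobi operator
(`IsBrinkmannFrame.profileMatrix_eq`). Hence ΔH = -2 tr K, and the Hessian of H is -(N + Nᵀ).

For a Riemannian extension, R(·, ∂_r)∂_r involves only γ and its `r`-derivatives, so on the axis it
equals K whatever the extension is (`IsExtension.sliceJacobiOp_axis`). There Ric(∂_r, ∂_r) = tr K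
and (∇_r Ric)(∂_r, ∂_r) = (tr K)', while (∇_r Rm)(·, ∂_r, ∂_r, ·), read in the parallel frame, is
the derivative of Nᵀ. Thus Ricci-flatness forces ΔH = 0, parallel Ricci forces ∂_u ΔH = 0, and local
symmetry forces N' = 0, hence H_{iju} = 0. -/

noncomputable section

namespace PlaneWave

/-! ### Linear differential equations -/

section LinearODE

open MeasureTheory

variable {R : Type*} [NormedRing R] [NormedAlgebra ℝ R]

/-- The terms of the Picard series of the linear equation `X' = A X` with `X 0 = X₀`. -/
def picardTerm (A : ℝ → R) (X₀ : R) : ℕ → ℝ → R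
  | 0 => fun _ => X₀
  | n + 1 => fun t => ∫ s in (0 : ℝ)..t, A s * picardTerm A X₀ n s

theorem continuous_picardTerm {A : ℝ → R} (hA : Continuous A) (X₀ : R) (n : ℕ) :
    Continuous (picardTerm A X₀ n) := by
  induction n with
  | zero => exact continuous_const
  | succ n ih =>
    have h : Continuous fun s => A s * picardTerm A X₀ n s := hA.mul ih
    exact intervalIntegral.continuous_primitive (μ := volume)
      (fun a b => h.intervalIntegrable a b) 0

theorem hasDerivAt_picardTerm_succ [CompleteSpace R] {A : ℝ → R} (hA : Continuous A) (X₀ : R) (n : ℕ) (t : ℝ) :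
    HasDerivAt (picardTerm A X₀ (n + 1)) (A t * picardTerm A X₀ n t) t :=
  (hA.mul (continuous_picardTerm hA X₀ n)).integral_hasStrictDerivAt 0 t |>.hasDerivAt

/-- Each integration of |s|ⁿ gains a factor |t|/(n + 1). The resulting factorial makes the Picard
series converge on every bounded interval, however large the coefficient, which is why the solution
is global. -/
theorem norm_picardTerm_le {A : ℝ → R} (hA : Continuous A) (X₀ : R) {M T : ℝ}
    (hM : ∀ s, |s| ≤ T → ‖A s‖ ≤ M) (n : ℕ) (t : ℝ) (ht : |t| ≤ T) :
    ‖picardTerm A X₀ n t‖ ≤ ‖X₀‖ * ((M * |t|) ^ n / n.factorial) := by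
  have hM0 : 0 ≤ M := (norm_nonneg _).trans (hM t ht)
  induction n generalizing t with
  | zero => simp [picardTerm]
  | succ n ih =>
    have hsub : ∀ s ∈ Set.uIoc 0 t, |s| ≤ T := fun s hs => by
      refine le_trans ?_ ht
      have := Set.abs_sub_left_of_mem_uIcc (Set.uIoc_subset_uIcc hs)
      simpa using this
    calc ‖picardTerm A X₀ (n + 1) t‖
        ≤ ∫ s in Set.uIoc 0 t, ‖A s * picardTerm A X₀ n s‖ :=
          intervalIntegral.norm_integral_le_integral_norm_uIoc
      _ ≤ ∫ s in Set.uIoc 0 t, ‖X₀‖ * M * (M ^ n / n.factorial) * |s - 0| ^ n := by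
          refine setIntegral_mono_on ?_ ?_ measurableSet_uIoc fun s hs => ?_
          · exact ((hA.mul (continuous_picardTerm hA X₀ n)).norm.intervalIntegrable 0 t).def'
          · exact (Continuous.intervalIntegrable (by fun_prop) 0 t).def'
          · have h1 := hM s (hsub s hs)
            have h2 := ih s (hsub s hs)
            calc ‖A s * picardTerm A X₀ n s‖ ≤ ‖A s‖ * ‖picardTerm A X₀ n s‖ := norm_mul_le _ _
              _ ≤ M * (‖X₀‖ * ((M * |s|) ^ n / n.factorial)) := by gcongr
              _ = _ := by rw [sub_zero, mul_pow]; ring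
      _ = ‖X₀‖ * ((M * |t|) ^ (n + 1) / (n + 1).factorial) := by
          rw [integral_const_mul, integral_pow_abs_sub_uIoc, Nat.factorial_succ]
          push_cast
          have : (n.factorial : ℝ) ≠ 0 := by positivity
          have : (n : ℝ) + 1 ≠ 0 := by positivity
          rw [sub_zero]
          field_simp
          rw [mul_pow]
          ring

/-- A linear differential equation with continuous coefficients has a global solution. -/
theorem exists_hasDerivAt_eq_mul [CompleteSpace R] {A : ℝ → R} (hA : Continuous A) (X₀ : R) :
    ∃ X : ℝ → R, X 0 = X₀ ∧ ∀ t, HasDerivAt X (A t * X t) t := by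
  have key : ∀ T : ℝ, 0 < T → ∀ t ∈ Metric.ball (0 : ℝ) T,
      Summable (fun n => picardTerm A X₀ n t) ∧
      HasDerivAt (fun t => ∑' n, picardTerm A X₀ (n + 1) t)
        (∑' n, A t * picardTerm A X₀ n t) t := by
    intro T hT t ht
    obtain ⟨M, hM⟩ := (isCompact_closedBall (0 : ℝ) T).exists_bound_of_continuousOn hA.continuousOn
    replace hM : ∀ s, |s| ≤ T → ‖A s‖ ≤ M := fun s hs => hM s (by simpa using hs)
    have hM0 : 0 ≤ M := (norm_nonneg _).trans (hM 0 (by simpa using hT.le))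
    have hsum : Summable fun n : ℕ => ‖X₀‖ * ((M * T) ^ n / n.factorial) :=
      (Real.summable_pow_div_factorial (M * T)).mul_left _
    have hbd : ∀ n s, s ∈ Metric.ball (0 : ℝ) T →
        ‖picardTerm A X₀ n s‖ ≤ ‖X₀‖ * ((M * T) ^ n / n.factorial) := fun n s hs => by
      have hs' : |s| ≤ T := by simpa using (Metric.ball_subset_closedBall hs)
      refine (norm_picardTerm_le hA X₀ hM n s hs').trans ?_
      gcongr
    have hs : ∀ s ∈ Metric.ball (0 : ℝ) T, Summable (fun n => picardTerm A X₀ n s) :=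
      fun s hs => .of_norm_bounded hsum fun n => hbd n s hs
    refine ⟨hs t ht, ?_⟩
    refine hasDerivAt_tsum_of_isPreconnected (hsum.mul_left M) Metric.isOpen_ball
      (convex_ball _ _).isPreconnected (fun n y _ => hasDerivAt_picardTerm_succ hA X₀ n y)
      (fun n y hy => ?_) ht ((summable_nat_add_iff 1).2 (hs t ht)) ht
    refine (norm_mul_le _ _).trans ?_
    have := hM y (by simpa using (Metric.ball_subset_closedBall hy))
    gcongr
    exact hbd n y hy
  have hmem : ∀ t : ℝ, t ∈ Metric.ball (0 : ℝ) (|t| + 1) := fun t => by simp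
  -- The constant zeroth term is split off: the shifted terms are primitives, and differentiating
  -- them termwise gives back A times the full series.
  refine ⟨fun t => X₀ + ∑' n, picardTerm A X₀ (n + 1) t, by simp [picardTerm], fun t => ?_⟩
  obtain ⟨h1, h2⟩ := key (|t| + 1) (by positivity) t (hmem t)
  have h3 : ∑' n, A t * picardTerm A X₀ n t = A t * (X₀ + ∑' n, picardTerm A X₀ (n + 1) t) := by
    rw [h1.tsum_mul_left, h1.tsum_eq_zero_add]
    rfl
  exact h3 ▸ h2.const_add X₀

end LinearODE

/-! ### Smooth matrix functions -/

section MatrixCalculus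

open Matrix

theorem contDiff_matrix_mul {E ι κ ν : Type*} [NormedAddCommGroup E] [NormedSpace ℝ E] [Fintype κ]
    {n : WithTop ℕ∞} {A : E → Matrix ι κ ℝ} {B : E → Matrix κ ν ℝ}
    (hA : ∀ i j, ContDiff ℝ n fun p => A p i j) (hB : ∀ i j, ContDiff ℝ n fun p => B p i j) (i : ι)
    (j : ν) : ContDiff ℝ n fun p => (A p * B p) i j := by
  simp only [mul_apply]
  exact ContDiff.sum fun k _ => (hA i k).mul (hB k j)

theorem contDiff_matrix_det {E ι : Type*} [NormedAddCommGroup E] [NormedSpace ℝ E] [Fintype ι]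
    [DecidableEq ι] {n : WithTop ℕ∞} {A : E → Matrix ι ι ℝ}
    (hA : ∀ i j, ContDiff ℝ n fun p => A p i j) : ContDiff ℝ n fun p => (A p).det := by
  simp only [det_apply']
  exact ContDiff.sum fun σ _ => contDiff_const.mul (contDiff_prod fun i _ => hA _ _)

theorem contDiff_matrix_inv {E ι : Type*} [NormedAddCommGroup E] [NormedSpace ℝ E] [Fintype ι]
    [DecidableEq ι] {n : WithTop ℕ∞} {A : E → Matrix ι ι ℝ}
    (hA : ∀ i j, ContDiff ℝ n fun p => A p i j) (hdet : ∀ p, IsUnit (A p)) (i j : ι) :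
    ContDiff ℝ n fun p => (A p)⁻¹ i j := by
  simp only [inv_def, Matrix.smul_apply, Ring.inverse_eq_inv', smul_eq_mul, adjugate_apply]
  refine ((contDiff_matrix_det hA).inv fun p => ?_).mul (contDiff_matrix_det fun k l => ?_)
  · exact ((isUnit_iff_isUnit_det _).1 (hdet p)).ne_zero
  · by_cases h : k = j
    · subst h
      simpa only [updateRow_self] using contDiff_const
    · simpa only [updateRow_ne h] using hA k l

variable {m : ℕ}

theorem contDiff_matDeriv {A : ℝ → Matrix (Fin m) (Fin m) ℝ}
    (hA : ∀ i j, ContDiff ℝ ∞ fun u => A u i j) (i j : Fin m) :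
    ContDiff ℝ ∞ fun u => matDeriv A u i j :=
  (contDiff_infty_iff_deriv.1 (hA i j)).2

theorem matDeriv_mul {A B : ℝ → Matrix (Fin m) (Fin m) ℝ}
    (hA : ∀ i j, ContDiff ℝ ∞ fun u => A u i j) (hB : ∀ i j, ContDiff ℝ ∞ fun u => B u i j)
    (u : ℝ) : matDeriv (fun s => A s * B s) u = matDeriv A u * B u + A u * matDeriv B u := by
  ext i j
  have hA' := fun i j => (hA i j).differentiable (by simp) u
  have hB' := fun i j => (hB i j).differentiable (by simp) u
  rw [Matrix.add_apply, mul_apply, mul_apply, ← Finset.sum_add_distrib]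
  simp only [matDeriv, of_apply, mul_apply]
  rw [deriv_fun_sum fun k _ => (hA' i k).fun_mul (hB' k j)]
  exact Finset.sum_congr rfl fun k _ => deriv_fun_mul (hA' i k) (hB' k j)

theorem matDeriv_transpose (A : ℝ → Matrix (Fin m) (Fin m) ℝ) (u : ℝ) :
    matDeriv (fun s => (A s)ᵀ) u = (matDeriv A u)ᵀ := rfl

theorem matDeriv_const_smul {A : ℝ → Matrix (Fin m) (Fin m) ℝ}
    (c : ℝ) (u : ℝ) : matDeriv (fun s => c • A s) u = c • matDeriv A u := by
  ext i j
  simp [matDeriv]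

theorem matDeriv_const (A : Matrix (Fin m) (Fin m) ℝ) (u : ℝ) : matDeriv (fun _ => A) u = 0 := by
  ext i j
  simp [matDeriv]

theorem eq_of_matDeriv_eq_zero {A : ℝ → Matrix (Fin m) (Fin m) ℝ}
    (hA : ∀ i j, ContDiff ℝ ∞ fun u => A u i j) (h : ∀ u, matDeriv A u = 0) (s t : ℝ) :
    A s = A t := by
  ext i j
  exact is_const_of_deriv_eq_zero ((hA i j).differentiable (by simp))
    (fun u => congrFun₂ (h u) i j) s t

open scoped Matrix.Norms.Operator in
theorem exists_matDeriv_eq_mul {A : ℝ → Matrix (Fin m) (Fin m) ℝ}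
    (hA : ∀ i j, ContDiff ℝ ∞ fun u => A u i j) (X₀ : Matrix (Fin m) (Fin m) ℝ) :
    ∃ X : ℝ → Matrix (Fin m) (Fin m) ℝ, X 0 = X₀ ∧ (∀ i j, ContDiff ℝ ∞ fun u => X u i j) ∧
      ∀ u, matDeriv X u = A u * X u := by
  obtain ⟨X, h0, hX⟩ := exists_hasDerivAt_eq_mul (A := A)
    (continuous_matrix fun i j => (hA i j).continuous) X₀
  have hX' : ∀ i j u, HasDerivAt (fun s => X s i j) ((A u * X u) i j) u := fun i j u =>
    ((entryLinearMap ℝ ℝ i j).toContinuousLinearMap.hasFDerivAt).comp_hasDerivAt u (hX u)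
  -- Bootstrap: if X is Cⁿ then X' = AX is Cⁿ, so X is Cⁿ⁺¹.
  refine ⟨X, h0, fun i j => contDiff_infty.2 fun n => ?_, fun u => ?_⟩
  · induction n generalizing i j with
    | zero => exact contDiff_zero.2 (continuous_iff_continuousAt.2 fun u => (hX' i j u).continuousAt)
    | succ n ih =>
      refine (contDiff_succ_iff_deriv (n := (n : WithTop ℕ∞))).2 ⟨fun u => (hX' i j u).differentiableAt, by simp, ?_⟩
      rw [funext fun u => (hX' i j u).deriv]
      exact contDiff_matrix_mul (fun i j => (hA i j).of_le (by exact_mod_cast le_top)) ih i j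
  · ext i j
    exact (hX' i j u).deriv

end MatrixCalculus

/-! ### Brinkmann frames -/

section Frame

open Matrix

variable {m : ℕ} {gbar C : ℝ → Matrix (Fin m) (Fin m) ℝ}

/-- Half the logarithmic derivative `½ gbar⁻¹ gbar'` of a family of metrics, the shape operator of
the slices of constant `r`. -/
def shapeOp (gbar : ℝ → Matrix (Fin m) (Fin m) ℝ) (r : ℝ) : Matrix (Fin m) (Fin m) ℝ :=
  (1 / 2 : ℝ) • ((gbar r)⁻¹ * matDeriv gbar r)

/-- The Jacobi operator `Z ↦ R(Z, ∂_r) ∂_r` of a family of metrics, as a matrix. -/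
def jacobiOp (gbar : ℝ → Matrix (Fin m) (Fin m) ℝ) (r : ℝ) : Matrix (Fin m) (Fin m) ℝ :=
  -(matDeriv (shapeOp gbar) r + shapeOp gbar r * shapeOp gbar r)

/-- The matrix `N` with `profile gbar C u x = -∑ N_{kl} xᵏ xˡ`. -/
def profileMatrix (gbar C : ℝ → Matrix (Fin m) (Fin m) ℝ) (u : ℝ) : Matrix (Fin m) (Fin m) ℝ :=
  (matDeriv (fun s => gbar s * matDeriv C s) u)ᵀ * C u

theorem posDef_transpose_eq {A : Matrix (Fin m) (Fin m) ℝ} (h : A.PosDef) : Aᵀ = A := by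
  simpa using h.isHermitian.eq

theorem matDeriv_transpose_eq (hpos : ∀ r, (gbar r).PosDef) (u : ℝ) :
    (matDeriv gbar u)ᵀ = matDeriv gbar u := by
  rw [← matDeriv_transpose]
  exact congrArg (matDeriv · u) (funext fun s => posDef_transpose_eq (hpos s))

theorem contDiff_shapeOp (hsmooth : ∀ i j, ContDiff ℝ ∞ fun r => gbar r i j)
    (hpos : ∀ r, (gbar r).PosDef) (i j : Fin m) : ContDiff ℝ ∞ fun u => shapeOp gbar u i j :=
  contDiff_const.mul (contDiff_matrix_mul (contDiff_matrix_inv hsmooth fun r => (hpos r).isUnit)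
    (contDiff_matDeriv hsmooth) i j)

theorem mul_shapeOp (hpos : ∀ r, (gbar r).PosDef) (u : ℝ) :
    gbar u * shapeOp gbar u = (1 / 2 : ℝ) • matDeriv gbar u := by
  rw [shapeOp, Matrix.mul_smul, mul_nonsing_inv_cancel_left _ _
    ((isUnit_iff_isUnit_det _).1 (hpos u).isUnit)]

theorem exists_transpose_mul_mul_eq_one {A : Matrix (Fin m) (Fin m) ℝ} (hA : A.PosDef) :
    ∃ B : Matrix (Fin m) (Fin m) ℝ, Bᵀ * A * B = 1 := by
  open scoped MatrixOrder Matrix.Norms.L2Operator in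
  obtain ⟨Y, hY⟩ := CStarAlgebra.nonneg_iff_eq_star_mul_self.mp hA.posSemidef.nonneg
  have hY' : A = Yᵀ * Y := by simpa [star_eq_conjTranspose] using hY
  have hdet : IsUnit Y.det := by
    have := (isUnit_iff_isUnit_det _).1 hA.isUnit
    rw [hY', det_mul, det_transpose] at this
    exact isUnit_of_mul_isUnit_left this
  refine ⟨Y⁻¹, ?_⟩
  rw [hY', ← Matrix.mul_assoc, ← transpose_mul, mul_nonsing_inv _ hdet, transpose_one,
    Matrix.one_mul, mul_nonsing_inv _ hdet]

/-- Every smooth family of metrics has a Brinkmann frame. -/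
theorem exists_isBrinkmannFrame (hsmooth : ∀ i j, ContDiff ℝ ∞ fun r => gbar r i j)
    (hpos : ∀ r, (gbar r).PosDef) : ∃ C, IsBrinkmannFrame gbar C := by
  obtain ⟨C₀, hC₀⟩ := exists_transpose_mul_mul_eq_one (hpos 0)
  -- Parallel transport of a frame that is orthonormal at 0.
  obtain ⟨C, h0, hC, hC'⟩ := exists_matDeriv_eq_mul (A := fun u => -shapeOp gbar u)
    (fun i j => (contDiff_shapeOp hsmooth hpos i j).neg) C₀
  have hCT : ∀ i j, ContDiff ℝ ∞ fun u => (C u)ᵀ i j := fun i j => hC j i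
  have h1 : ∀ u, (C u)ᵀ * gbar u * matDeriv C u
      = -(1 / 2 : ℝ) • ((C u)ᵀ * matDeriv gbar u * C u) := fun u => by
    rw [hC', Matrix.mul_assoc, ← Matrix.mul_assoc (gbar u), mul_neg, mul_shapeOp hpos]
    simp [Matrix.mul_assoc]
  have h2 : ∀ u, (matDeriv C u)ᵀ * gbar u * C u
      = -(1 / 2 : ℝ) • ((C u)ᵀ * matDeriv gbar u * C u) := fun u => by
    have := congrArg transpose (h1 u)
    simpa [transpose_mul, posDef_transpose_eq (hpos u), matDeriv_transpose_eq hpos,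
      Matrix.mul_assoc] using this
  refine ⟨C, hC, fun u => ?_, fun u => (h2 u).trans (h1 u).symm⟩
  -- CᵀḡC is constant: the three terms of its derivative are -½, 1 and -½ times Cᵀḡ'C.
  rw [← hC₀, ← h0]
  refine eq_of_matDeriv_eq_zero (A := fun u => (C u)ᵀ * gbar u * C u)
    (contDiff_matrix_mul (contDiff_matrix_mul hCT hsmooth) hC) (fun s => ?_) u 0
  rw [matDeriv_mul (contDiff_matrix_mul hCT hsmooth) hC, matDeriv_mul hCT hsmooth,
    matDeriv_transpose, Matrix.add_mul, h1, h2]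
  module

namespace IsBrinkmannFrame

variable (hC : IsBrinkmannFrame gbar C)
include hC

theorem mul_transpose_mul (u : ℝ) : C u * ((C u)ᵀ * gbar u) = 1 :=
  mul_eq_one_comm.1 (hC.orthonormal u)

/-- By symmetry, the derivative of CᵀḡC = 1 reads 2CᵀḡC' + Cᵀḡ'C = 0, and the invertible factor Cᵀ
cancels. -/
theorem mul_matDeriv (hsmooth : ∀ i j, ContDiff ℝ ∞ fun r => gbar r i j) (u : ℝ) :
    gbar u * matDeriv C u = -(1 / 2 : ℝ) • (matDeriv gbar u * C u) := by
  have hCT : ∀ i j, ContDiff ℝ ∞ fun u => (C u)ᵀ i j := fun i j => hC.smooth j i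
  have h : matDeriv (fun u => (C u)ᵀ * gbar u * C u) u = 0 := by
    rw [funext hC.orthonormal, matDeriv_const]
  rw [matDeriv_mul (contDiff_matrix_mul hCT hsmooth) hC.smooth, matDeriv_mul hCT hsmooth,
    matDeriv_transpose, Matrix.add_mul, hC.symm] at h
  have hinv : gbar u * C u * (C u)ᵀ = 1 := by
    rw [← mul_eq_one_comm, ← Matrix.mul_assoc, hC.orthonormal]
  have h2 := congrArg (gbar u * C u * ·) h
  simp only [Matrix.mul_add, Matrix.mul_assoc, Matrix.mul_zero] at h2
  have h3 : ∀ X : Matrix (Fin m) (Fin m) ℝ, gbar u * (C u * ((C u)ᵀ * X)) = X := fun X => by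
    rw [← Matrix.mul_assoc, ← Matrix.mul_assoc, hinv, Matrix.one_mul]
  rw [h3, h3] at h2
  have h4 : gbar u * matDeriv C u + gbar u * matDeriv C u = -(matDeriv gbar u * C u) := by
    rw [eq_neg_iff_add_eq_zero, ← h2]
    abel
  rw [neg_smul, ← smul_neg, ← h4]
  module

theorem matDeriv_eq (hsmooth : ∀ i j, ContDiff ℝ ∞ fun r => gbar r i j)
    (hpos : ∀ r, (gbar r).PosDef) (u : ℝ) : matDeriv C u = -(shapeOp gbar u * C u) := by
  have hdet := (isUnit_iff_isUnit_det _).1 (hpos u).isUnit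
  rw [← nonsing_inv_mul_cancel_left _ (matDeriv C u) hdet, hC.mul_matDeriv hsmooth, shapeOp]
  simp [Matrix.mul_assoc]

/-- By `mul_matDeriv`, ḡC' = -½ḡ'C. Differentiating once more with C' = -SC gives -½(ḡ'' - ḡ'S)C.
Differentiating ḡS = ½ḡ' identifies -½(ḡ'' - ḡ'S) with ḡK. -/
theorem profileMatrix_eq (hsmooth : ∀ i j, ContDiff ℝ ∞ fun r => gbar r i j)
    (hpos : ∀ r, (gbar r).PosDef) (u : ℝ) :
    profileMatrix gbar C u = (C u)ᵀ * gbar u * jacobiOp gbar u * C u := by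
  have hB := contDiff_shapeOp hsmooth hpos
  have hg := contDiff_matDeriv hsmooth
  have h1 : gbar u * matDeriv (shapeOp gbar) u
      = (1 / 2 : ℝ) • matDeriv (matDeriv gbar) u - matDeriv gbar u * shapeOp gbar u := by
    rw [eq_sub_iff_add_eq', ← matDeriv_mul hsmooth hB, funext (mul_shapeOp hpos),
      matDeriv_const_smul]
  have h2 : matDeriv (fun s => gbar s * matDeriv C s) u
      = -(1 / 2 : ℝ) • ((matDeriv (matDeriv gbar) u - matDeriv gbar u * shapeOp gbar u) * C u) := by
    rw [funext (hC.mul_matDeriv hsmooth), matDeriv_const_smul, matDeriv_mul hg hC.smooth,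
      hC.matDeriv_eq hsmooth hpos, Matrix.sub_mul, mul_neg, Matrix.mul_assoc, sub_eq_add_neg]
  -- The product is ½ ḡ'ḡ⁻¹ḡ', visibly symmetric.
  have h3 : (matDeriv gbar u * shapeOp gbar u)ᵀ = matDeriv gbar u * shapeOp gbar u := by
    rw [shapeOp, Matrix.mul_smul, transpose_smul, transpose_mul, transpose_mul, transpose_nonsing_inv,
      posDef_transpose_eq (hpos u), matDeriv_transpose_eq hpos, Matrix.mul_assoc]
  have h4 : (matDeriv (matDeriv gbar) u)ᵀ = matDeriv (matDeriv gbar) u := by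
    rw [← matDeriv_transpose, funext (matDeriv_transpose_eq hpos)]
  have h5 : gbar u * jacobiOp gbar u
      = -(1 / 2 : ℝ) • (matDeriv (matDeriv gbar) u - matDeriv gbar u * shapeOp gbar u) := by
    rw [jacobiOp, mul_neg, Matrix.mul_add, h1, ← Matrix.mul_assoc, mul_shapeOp hpos,
      smul_mul]
    module
  rw [profileMatrix, h2, transpose_smul, transpose_mul, transpose_sub, h3, h4, Matrix.mul_assoc _ᵀ,
    h5, Matrix.mul_smul, Matrix.smul_mul]

theorem trace_profileMatrix (hsmooth : ∀ i j, ContDiff ℝ ∞ fun r => gbar r i j)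
    (hpos : ∀ r, (gbar r).PosDef) (u : ℝ) :
    (profileMatrix gbar C u).trace = (jacobiOp gbar u).trace := by
  rw [hC.profileMatrix_eq hsmooth hpos, trace_mul_comm, ← Matrix.mul_assoc, hC.mul_transpose_mul,
    Matrix.one_mul]

end IsBrinkmannFrame

end Frame

/-! ### Partial derivatives -/

section PartialDerivatives

variable {ι : Type*} [Fintype ι] [DecidableEq ι] {f g : (ι → ℝ) → ℝ} {p : ι → ℝ}

omit [Fintype ι] in
theorem partialD_const (a : ι) (c : ℝ) (p : ι → ℝ) : partialD a (fun _ => c) p = 0 := by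
  simp [partialD]

theorem partialD_comp_coord {F : ℝ → ℝ} (a b : ι) (hF : DifferentiableAt ℝ F (p b)) :
    partialD a (fun q => F (q b)) p = deriv F (p b) * (Pi.single a 1 : ι → ℝ) b := by
  have h : HasFDerivAt (fun q : ι → ℝ => F (q b))
      (deriv F (p b) • (ContinuousLinearMap.proj b : (ι → ℝ) →L[ℝ] ℝ)) p :=
    hF.hasDerivAt.comp_hasFDerivAt p (hasFDerivAt_apply b p)
  simp [partialD, h.fderiv]

theorem partialD_coord (a b : ι) (p : ι → ℝ) :
    partialD a (fun q => q b) p = (Pi.single a 1 : ι → ℝ) b := by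
  simpa using partialD_comp_coord (F := id) a b differentiableAt_id

theorem partialD_mul (a : ι) (hf : DifferentiableAt ℝ f p) (hg : DifferentiableAt ℝ g p) :
    partialD a (fun q => f q * g q) p = partialD a f p * g p + f p * partialD a g p := by
  simp only [partialD, fderiv_fun_mul hf hg]
  simp
  ring

theorem partialD_sub (a : ι) (hf : DifferentiableAt ℝ f p) (hg : DifferentiableAt ℝ g p) :
    partialD a (fun q => f q - g q) p = partialD a f p - partialD a g p := by
  simp [partialD, fderiv_fun_sub hf hg]

theorem partialD_const_mul (a : ι) (c : ℝ) (hf : DifferentiableAt ℝ f p) :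
    partialD a (fun q => c * f q) p = c * partialD a f p := by
  rw [partialD_mul a (differentiableAt_const c) hf, partialD_const, zero_mul, zero_add]

theorem partialD_sum {κ : Type*} (s : Finset κ) {f : κ → (ι → ℝ) → ℝ} (a : ι)
    (hf : ∀ k ∈ s, DifferentiableAt ℝ (f k) p) :
    partialD a (fun q => ∑ k ∈ s, f k q) p = ∑ k ∈ s, partialD a (f k) p := by
  simp [partialD, fderiv_fun_sum hf]

theorem contDiff_partialD (a : ι) (hf : ContDiff ℝ ∞ f) : ContDiff ℝ ∞ (partialD a f) :=
  (hf.fderiv_right (m := ∞) (by simp)).clm_apply contDiff_const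

end PartialDerivatives

/-! ### Brinkmann coordinates -/

section Coordinates

open Matrix

variable {m : ℕ} {gbar C : ℝ → Matrix (Fin m) (Fin m) ℝ}

/-- The second fundamental form `(∂_u Cⁱ_k) gbar_{ij} Cʲ_l` of a Brinkmann frame. -/
def frameForm (gbar C : ℝ → Matrix (Fin m) (Fin m) ℝ) (u : ℝ) : Matrix (Fin m) (Fin m) ℝ :=
  (matDeriv C u)ᵀ * gbar u * C u

theorem brinkmannToRosen_r (p : Fin 2 ⊕ Fin m → ℝ) :
    brinkmannToRosen gbar C p (Sum.inl 0) = p (Sum.inl 1) := rfl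

theorem brinkmannToRosen_x (p : Fin 2 ⊕ Fin m → ℝ) (i : Fin m) :
    brinkmannToRosen gbar C p (Sum.inr i) = ∑ k, C (p (Sum.inl 1)) i k * p (Sum.inr k) := rfl

theorem brinkmannToRosen_t (p : Fin 2 ⊕ Fin m → ℝ) :
    brinkmannToRosen gbar C p (Sum.inl 1) = p (Sum.inl 0) - (1 / 2) * ∑ k, ∑ l,
      frameForm gbar C (p (Sum.inl 1)) k l * p (Sum.inr k) * p (Sum.inr l) := by
  have h : ∀ u (x : Fin m → ℝ), ∑ i, ∑ j, ∑ k, ∑ l, gbar u i j * matDeriv C u i k * C u j l * x k * x l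
      = ∑ k, ∑ l, frameForm gbar C u k l * x k * x l := fun u x => by
    simp only [frameForm, mul_apply, transpose_apply, Finset.sum_mul]
    rw [Finset.sum_comm]
    rw [Finset.sum_congr rfl fun _ _ => Finset.sum_comm]
    rw [Finset.sum_comm]
    refine Finset.sum_congr rfl fun k _ => ?_
    rw [Finset.sum_congr rfl fun _ _ => Finset.sum_comm]
    rw [Finset.sum_comm]
    refine Finset.sum_congr rfl fun l _ => Finset.sum_congr rfl fun j _ =>
      Finset.sum_congr rfl fun i _ => by ring
  rw [← h (p (Sum.inl 1)) fun k => p (Sum.inr k)]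
  rfl

theorem profile_eq_sum (hpos : ∀ r, (gbar r).PosDef) (u : ℝ) (x : EuclideanSpace ℝ (Fin m)) :
    profile gbar C u x = -∑ k, ∑ l, profileMatrix gbar C u k l * x k * x l := by
  -- The contraction runs over the first index of ḡ, so its symmetry is needed to recognise a matrix
  -- product.
  have h : ∀ j k, deriv (fun s => ∑ i, gbar s i j * matDeriv C s i k) u
      = matDeriv (fun s => gbar s * matDeriv C s) u j k := fun j k => by
    simp only [matDeriv, of_apply, mul_apply]
    congr 1
    ext s
    refine Finset.sum_congr rfl fun i _ => ?_
    rw [← congrFun₂ (posDef_transpose_eq (hpos s)) i j, transpose_apply]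
  simp only [profile, h, profileMatrix, mul_apply (M := _ᵀ), transpose_apply, Finset.sum_mul]
  rw [Finset.sum_comm]
  exact congrArg _ (Finset.sum_congr rfl fun k _ => Finset.sum_comm)

theorem dotProduct_mulVec_eq_sum (A : Matrix (Fin m) (Fin m) ℝ) (x : Fin m → ℝ) :
    x ⬝ᵥ A *ᵥ x = ∑ k, ∑ l, A k l * x k * x l := by
  simp only [dotProduct, mulVec, Finset.mul_sum]
  exact Finset.sum_congr rfl fun k _ => Finset.sum_congr rfl fun l _ => by ring

theorem mulVec_dotProduct_mulVec (A B D : Matrix (Fin m) (Fin m) ℝ) (x y : Fin m → ℝ) :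
    (A *ᵥ x) ⬝ᵥ D *ᵥ B *ᵥ y = x ⬝ᵥ (Aᵀ * D * B) *ᵥ y := by
  rw [← mulVec_mulVec, ← mulVec_mulVec, dotProduct_mulVec x, vecMul_transpose]

namespace IsBrinkmannFrame

variable (hC : IsBrinkmannFrame gbar C) (hsmooth : ∀ i j, ContDiff ℝ ∞ fun r => gbar r i j)
include hC

theorem transpose_frameForm (hpos : ∀ r, (gbar r).PosDef) (u : ℝ) :
    (frameForm gbar C u)ᵀ = frameForm gbar C u := by
  rw [frameForm, hC.symm]
  simp [transpose_mul, posDef_transpose_eq (hpos u), Matrix.mul_assoc, ← hC.symm]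

include hsmooth

theorem contDiff_frameForm (k l : Fin m) : ContDiff ℝ ∞ fun u => frameForm gbar C u k l :=
  contDiff_matrix_mul (contDiff_matrix_mul
    (fun i j => contDiff_matDeriv hC.smooth j i) hsmooth) hC.smooth k l

theorem contDiff_brinkmannToRosen : ContDiff ℝ ∞ (brinkmannToRosen gbar C) := by
  have hS := hC.contDiff_frameForm hsmooth
  have hc := hC.smooth
  refine contDiff_pi.2 ?_
  rintro (a | i)
  · fin_cases a
    · exact contDiff_apply ℝ ℝ _
    · simp only [Fin.mk_one, brinkmannToRosen_t]
      refine (contDiff_apply ℝ ℝ _).sub (contDiff_const.mul (ContDiff.sum fun k _ =>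
        ContDiff.sum fun l _ => ?_))
      exact (((hS k l).comp (contDiff_apply ℝ ℝ _)).mul (contDiff_apply ℝ ℝ _)).mul
        (contDiff_apply ℝ ℝ _)
  · simp only [brinkmannToRosen_x]
    exact ContDiff.sum fun k _ => ((hc i k).comp (contDiff_apply ℝ ℝ _)).mul (contDiff_apply ℝ ℝ _)

/-- Brinkmann coordinates are global coordinates. -/
theorem isSmoothDiffeo_brinkmannToRosen : IsSmoothDiffeo (brinkmannToRosen gbar C) := by
  have hS := hC.contDiff_frameForm hsmooth
  -- Orthonormality makes Cᵀḡ the inverse of C, so x = Cᵀḡx̃ recovers the Brinkmann coordinates with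
  -- no further choice.
  let D : ℝ → Matrix (Fin m) (Fin m) ℝ := fun u => (C u)ᵀ * gbar u
  have hD : ∀ i j, ContDiff ℝ ∞ fun u => D u i j :=
    contDiff_matrix_mul (fun i j => hC.smooth j i) hsmooth
  let X : (Fin 2 ⊕ Fin m → ℝ) → Fin m → ℝ := fun q => D (q (Sum.inl 0)) *ᵥ fun i => q (Sum.inr i)
  have hX : ∀ k, ContDiff ℝ ∞ fun q => X q k := fun k => by
    simp only [X, mulVec, dotProduct]
    exact ContDiff.sum fun l _ => ((hD k l).comp (contDiff_apply ℝ ℝ _)).mul (contDiff_apply ℝ ℝ _)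
  let Ψ : (Fin 2 ⊕ Fin m → ℝ) → (Fin 2 ⊕ Fin m → ℝ) := fun q => Sum.elim
    ![q (Sum.inl 1) + (1 / 2) * ∑ k, ∑ l, frameForm gbar C (q (Sum.inl 0)) k l * X q k * X q l,
      q (Sum.inl 0)] (X q)
  have hXΦ : ∀ p i, X (brinkmannToRosen gbar C p) i = p (Sum.inr i) := fun p i => by
    have : X (brinkmannToRosen gbar C p)
        = D (p (Sum.inl 1)) *ᵥ (C (p (Sum.inl 1)) *ᵥ fun i => p (Sum.inr i)) := rfl
    rw [this, mulVec_mulVec, hC.orthonormal, one_mulVec]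
  have hCX : ∀ q i, ∑ k, C (q (Sum.inl 0)) i k * X q k = q (Sum.inr i) := fun q i => by
    have : ∑ k, C (q (Sum.inl 0)) i k * X q k
        = (C (q (Sum.inl 0)) *ᵥ (D (q (Sum.inl 0)) *ᵥ fun i => q (Sum.inr i))) i := rfl
    rw [this, mulVec_mulVec, hC.mul_transpose_mul, one_mulVec]
  refine ⟨hC.contDiff_brinkmannToRosen hsmooth, Ψ, contDiff_pi.2 ?_, fun p => ?_, fun q => ?_⟩
  · rintro (a | i)
    · fin_cases a
      · refine ContDiff.add (contDiff_apply ℝ ℝ _) (contDiff_const.mul (ContDiff.sum fun k _ =>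
          ContDiff.sum fun l _ => ?_))
        exact (((hS k l).comp (contDiff_apply ℝ ℝ _)).mul (hX k)).mul (hX l)
      · exact contDiff_apply ℝ ℝ _
    · exact hX i
  · funext b
    obtain (a | i) := b
    · fin_cases a
      · simp [Ψ, hXΦ, brinkmannToRosen_t, brinkmannToRosen_r]
      · simp [Ψ, brinkmannToRosen_r]
    · simp [Ψ, hXΦ]
  · funext b
    obtain (a | i) := b
    · fin_cases a
      · simp [Ψ, brinkmannToRosen_r]
      · simp [Ψ, brinkmannToRosen_t]
    · simpa [Ψ, brinkmannToRosen_x] using hCX q i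

omit hC hsmooth in
theorem partialD_brinkmannToRosen_r (a : Fin 2 ⊕ Fin m) (p : Fin 2 ⊕ Fin m → ℝ) :
    partialD a (fun q => brinkmannToRosen gbar C q (Sum.inl 0)) p
      = (Pi.single a 1 : Fin 2 ⊕ Fin m → ℝ) (Sum.inl 1) :=
  partialD_coord a _ p

omit hsmooth in
theorem partialD_brinkmannToRosen_x (a : Fin 2 ⊕ Fin m) (p : Fin 2 ⊕ Fin m → ℝ) (i : Fin m) :
    partialD a (fun q => brinkmannToRosen gbar C q (Sum.inr i)) p
      = ∑ k, (matDeriv C (p (Sum.inl 1)) i k * (Pi.single a 1 : Fin 2 ⊕ Fin m → ℝ) (Sum.inl 1)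
          * p (Sum.inr k)
        + C (p (Sum.inl 1)) i k * (Pi.single a 1 : Fin 2 ⊕ Fin m → ℝ) (Sum.inr k)) := by
  have hc := fun k => (hC.smooth i k).differentiable (by simp)
  have hc' : ∀ k, Differentiable ℝ fun q : Fin 2 ⊕ Fin m → ℝ => C (q (Sum.inl 1)) i k := fun k =>
    (hc k).comp (differentiable_apply _)
  have hx : ∀ k, Differentiable ℝ fun q : Fin 2 ⊕ Fin m → ℝ => q (Sum.inr k) := fun k =>
    differentiable_apply _
  simp only [brinkmannToRosen_x]
  rw [partialD_sum _ a fun k _ => ((hc' k).fun_mul (hx k)) p]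
  refine Finset.sum_congr rfl fun k _ => ?_
  rw [partialD_mul a (hc' k p) (hx k p), partialD_comp_coord (F := fun u => C u i k) a _ (hc k _),
    partialD_coord]
  rfl

theorem partialD_brinkmannToRosen_t (a : Fin 2 ⊕ Fin m) (p : Fin 2 ⊕ Fin m → ℝ) :
    partialD a (fun q => brinkmannToRosen gbar C q (Sum.inl 1)) p
      = (Pi.single a 1 : Fin 2 ⊕ Fin m → ℝ) (Sum.inl 0) - (1 / 2) * ∑ k, ∑ l,
        ((matDeriv (frameForm gbar C) (p (Sum.inl 1)) k l
            * (Pi.single a 1 : Fin 2 ⊕ Fin m → ℝ) (Sum.inl 1) * p (Sum.inr k)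
          + frameForm gbar C (p (Sum.inl 1)) k l
            * (Pi.single a 1 : Fin 2 ⊕ Fin m → ℝ) (Sum.inr k)) * p (Sum.inr l)
        + frameForm gbar C (p (Sum.inl 1)) k l * p (Sum.inr k)
            * (Pi.single a 1 : Fin 2 ⊕ Fin m → ℝ) (Sum.inr l)) := by
  have hS := fun k l => (hC.contDiff_frameForm hsmooth k l).differentiable (by simp)
  have hS' : ∀ k l, Differentiable ℝ fun q : Fin 2 ⊕ Fin m → ℝ =>
    frameForm gbar C (q (Sum.inl 1)) k l := fun k l => (hS k l).comp (differentiable_apply _)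
  have hx : ∀ k, Differentiable ℝ fun q : Fin 2 ⊕ Fin m → ℝ => q (Sum.inr k) := fun k =>
    differentiable_apply _
  have hSx : ∀ k l, Differentiable ℝ fun q : Fin 2 ⊕ Fin m → ℝ =>
    frameForm gbar C (q (Sum.inl 1)) k l * q (Sum.inr k) := fun k l => (hS' k l).mul (hx k)
  have hSxx : ∀ k l, Differentiable ℝ fun q : Fin 2 ⊕ Fin m → ℝ =>
    frameForm gbar C (q (Sum.inl 1)) k l * q (Sum.inr k) * q (Sum.inr l) := fun k l =>
      (hSx k l).mul (hx l)
  have hsum : ∀ k, Differentiable ℝ fun q : Fin 2 ⊕ Fin m → ℝ => ∑ l,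
    frameForm gbar C (q (Sum.inl 1)) k l * q (Sum.inr k) * q (Sum.inr l) := fun k =>
      Differentiable.fun_sum fun l _ => hSxx k l
  have hsum' : Differentiable ℝ fun q : Fin 2 ⊕ Fin m → ℝ => ∑ k, ∑ l,
    frameForm gbar C (q (Sum.inl 1)) k l * q (Sum.inr k) * q (Sum.inr l) :=
      Differentiable.fun_sum fun k _ => hsum k
  simp only [brinkmannToRosen_t]
  rw [partialD_sub a (differentiable_apply _ _) ((hsum'.const_mul _) p), partialD_coord,
    partialD_const_mul a _ (hsum' p), partialD_sum _ a fun k _ => hsum k p]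
  congr 2
  refine Finset.sum_congr rfl fun k _ => ?_
  rw [partialD_sum _ a fun l _ => hSxx k l p]
  refine Finset.sum_congr rfl fun l _ => ?_
  rw [partialD_mul a (hSx k l p) (hx l p), partialD_mul a (hS' k l p) (hx k p), partialD_coord,
    partialD_coord, partialD_comp_coord (F := fun u => frameForm gbar C u k l) a _ (hS k l _)]
  rfl

omit hC hsmooth in
theorem pullbackMetric_planeWave_apply (Φ : (Fin 2 ⊕ Fin m → ℝ) → Fin 2 ⊕ Fin m → ℝ)
    (p : Fin 2 ⊕ Fin m → ℝ) (a b : Fin 2 ⊕ Fin m) :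
    pullbackMetric Φ (planeWave gbar) p a b
      = partialD a (fun q => Φ q (Sum.inl 0)) p * partialD b (fun q => Φ q (Sum.inl 1)) p
        + partialD a (fun q => Φ q (Sum.inl 1)) p * partialD b (fun q => Φ q (Sum.inl 0)) p
        + (fun i => partialD a (fun q => Φ q (Sum.inr i)) p) ⬝ᵥ
          gbar (Φ p (Sum.inl 0)) *ᵥ fun i => partialD b (fun q => Φ q (Sum.inr i)) p := by
  simp only [pullbackMetric, planeWave, of_apply, Fintype.sum_sum_type, Fin.sum_univ_two,
    fromBlocks_apply₁₁, fromBlocks_apply₁₂, fromBlocks_apply₂₁, fromBlocks_apply₂₂]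
  simp [dotProduct, mulVec, Finset.mul_sum]
  refine Finset.sum_congr rfl fun k _ => Finset.sum_congr rfl fun l _ => by ring

/-- The term C'ᵀḡC' is exactly the part of the `du²` coefficient contributed by the transverse
metric; it cancels in the pullback and leaves only the profile. -/
theorem matDeriv_frameForm (hpos : ∀ r, (gbar r).PosDef) (u : ℝ) :
    matDeriv (frameForm gbar C) u
      = profileMatrix gbar C u + (matDeriv C u)ᵀ * gbar u * matDeriv C u := by
  have hC' := contDiff_matDeriv hC.smooth
  have h : frameForm gbar C = fun s => (gbar s * matDeriv C s)ᵀ * C s := funext fun s => by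
    rw [frameForm, transpose_mul, posDef_transpose_eq (hpos s)]
  rw [h, matDeriv_mul (A := fun s => (gbar s * matDeriv C s)ᵀ)
      (fun i j => contDiff_matrix_mul hsmooth hC' j i) hC.smooth,
    matDeriv_transpose, transpose_mul, posDef_transpose_eq (hpos u), profileMatrix]

/-- The plane wave metric in Brinkmann coordinates. -/
theorem pullbackMetric_brinkmannToRosen (hpos : ∀ r, (gbar r).PosDef) :
    pullbackMetric (brinkmannToRosen gbar C) (planeWave gbar)
      = brinkmannMetric (profile gbar C) := by
  funext p
  set u := p (Sum.inl 1) with hu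
  set x : Fin m → ℝ := fun k => p (Sum.inr k) with hx
  set S := frameForm gbar C u with hS
  have Rv : partialD (Sum.inl 0) (fun q => brinkmannToRosen gbar C q (Sum.inl 0)) p = 0 := by
    simp [partialD_brinkmannToRosen_r]
  have Ru : partialD (Sum.inl 1) (fun q => brinkmannToRosen gbar C q (Sum.inl 0)) p = 1 := by
    simp [partialD_brinkmannToRosen_r]
  have Rx : ∀ k, partialD (Sum.inr k) (fun q => brinkmannToRosen gbar C q (Sum.inl 0)) p = 0 := by
    simp [partialD_brinkmannToRosen_r]
  have Xv : (fun i => partialD (Sum.inl 0) (fun q => brinkmannToRosen gbar C q (Sum.inr i)) p)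
      = 0 := by
    funext i
    simp [hC.partialD_brinkmannToRosen_x]
  have Xu : (fun i => partialD (Sum.inl 1) (fun q => brinkmannToRosen gbar C q (Sum.inr i)) p)
      = matDeriv C u *ᵥ x := by
    funext i
    simp [hC.partialD_brinkmannToRosen_x, mulVec, dotProduct, hu, hx]
  have Xx : ∀ k, (fun i => partialD (Sum.inr k) (fun q => brinkmannToRosen gbar C q (Sum.inr i)) p)
      = C u *ᵥ Pi.single k 1 := by
    intro k
    funext i
    simp [hC.partialD_brinkmannToRosen_x, Pi.single_apply, hu]
  have Tv : partialD (Sum.inl 0) (fun q => brinkmannToRosen gbar C q (Sum.inl 1)) p = 1 := by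
    simp [hC.partialD_brinkmannToRosen_t hsmooth]
  have Tu : partialD (Sum.inl 1) (fun q => brinkmannToRosen gbar C q (Sum.inl 1)) p
      = -(1 / 2) * (x ⬝ᵥ matDeriv (frameForm gbar C) u *ᵥ x) := by
    simp [hC.partialD_brinkmannToRosen_t hsmooth, dotProduct_mulVec_eq_sum, hu, hx]
  have Tx : ∀ k, partialD (Sum.inr k) (fun q => brinkmannToRosen gbar C q (Sum.inl 1)) p
      = -(Pi.single k 1 ⬝ᵥ S *ᵥ x) := by
    intro k
    have hsymm : ∀ l, S l k = S k l := fun l =>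
      (congrFun₂ (hC.transpose_frameForm hpos u) k l)
    simp [hC.partialD_brinkmannToRosen_t hsmooth, Pi.single_apply, Finset.sum_add_distrib,
      mulVec, dotProduct, ← hu, ← hS, hsymm, hx]
    ring
  have hH : profile gbar C u (WithLp.toLp 2 x) = -(x ⬝ᵥ profileMatrix gbar C u *ᵥ x) := by
    rw [profile_eq_sum hpos, dotProduct_mulVec_eq_sum]
  have hu' : brinkmannToRosen gbar C p (Sum.inl 0) = u := rfl
  ext a b
  rw [pullbackMetric_planeWave_apply, hu']
  obtain (a | k) := a <;> obtain (b | l) := b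
  · fin_cases a <;> fin_cases b
    · simp [Rv, Xv, brinkmannMetric]
    · simp [Rv, Ru, Xv, Tv, brinkmannMetric]
    · simp [Rv, Ru, Xv, Tv, brinkmannMetric]
    · simp only [Fin.mk_one, Ru, Tu, Xu, mulVec_dotProduct_mulVec, matDeriv_frameForm hC hsmooth hpos,
        add_mulVec, dotProduct_add]
      have h : brinkmannMetric (profile gbar C) p (Sum.inl 1) (Sum.inl 1)
          = -(x ⬝ᵥ profileMatrix gbar C u *ᵥ x) := hH
      rw [h]
      ring
  · fin_cases a
    · simp [Rv, Rx, Xv, brinkmannMetric]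
    -- The mixed `du dx` terms from 2 dr dt and from the transverse metric are opposite because the
    -- frame form is symmetric; the quadratic correction in t is chosen for this.
    · simp only [Fin.mk_one, Ru, Rx, Tx, Xu, Xx, mulVec_dotProduct_mulVec, brinkmannMetric,
        fromBlocks_apply₁₂]
      rw [← frameForm, ← hS, dotProduct_mulVec x, ← mulVec_transpose, hS,
        hC.transpose_frameForm hpos, dotProduct_comm (_ *ᵥ x)]
      simp
  · fin_cases b
    · simp [Rv, Rx, Xv, brinkmannMetric]
    · simp only [Fin.mk_one, Ru, Rx, Tx, Xu, Xx, mulVec_dotProduct_mulVec, brinkmannMetric,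
        fromBlocks_apply₂₁]
      rw [← hC.symm, ← frameForm, ← hS]
      simp
  · simp only [Rx, Xx, mulVec_dotProduct_mulVec, hC.orthonormal, brinkmannMetric,
      fromBlocks_apply₂₂]
    simp [Matrix.one_apply]

end IsBrinkmannFrame

end Coordinates

/-! ### The Hessian and the Laplacian of the profile -/

section ProfileHessian

variable {m : ℕ} {gbar C : ℝ → Matrix (Fin m) (Fin m) ℝ}

theorem iteratedFDeriv_two_quadratic (N : Matrix (Fin m) (Fin m) ℝ)
    (x : EuclideanSpace ℝ (Fin m)) (i j : Fin m) :
    iteratedFDeriv ℝ 2 (fun y : EuclideanSpace ℝ (Fin m) => -∑ k, ∑ l, N k l * y k * y l) x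
      ![EuclideanSpace.single i 1, EuclideanSpace.single j 1] = -(N i j + N j i) := by
  let π : Fin m → (EuclideanSpace ℝ (Fin m) →L[ℝ] ℝ) := fun k => EuclideanSpace.proj k
  have h1 : ∀ y : EuclideanSpace ℝ (Fin m), HasFDerivAt
      (fun y : EuclideanSpace ℝ (Fin m) => -∑ k, ∑ l, N k l * y k * y l)
      (-∑ k, ∑ l, ((N k l * y k) • π l + y l • N k l • π k)) y := fun y =>
    (HasFDerivAt.fun_sum fun k _ => HasFDerivAt.fun_sum fun l _ =>
      ((π k).hasFDerivAt.const_mul (N k l)).mul (π l).hasFDerivAt).neg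
  -- The gradient of a quadratic form is linear in the point, so the second derivative is this
  -- constant map.
  let L : EuclideanSpace ℝ (Fin m) →L[ℝ] (EuclideanSpace ℝ (Fin m) →L[ℝ] ℝ) :=
    -∑ k, ∑ l, ((N k l • π k).smulRight (π l) + (π l).smulRight (N k l • π k))
  have h2 : fderiv ℝ (fun y : EuclideanSpace ℝ (Fin m) => -∑ k, ∑ l, N k l * y k * y l) = L := by
    funext y
    rw [(h1 y).fderiv]
    ext z
    simp [L, π]
  rw [iteratedFDeriv_two_apply, h2, L.fderiv]
  simp [L, π, Finset.sum_add_distrib]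

theorem spatialHessian_profile (hpos : ∀ r, (gbar r).PosDef) (i j : Fin m) (u : ℝ)
    (x : EuclideanSpace ℝ (Fin m)) : spatialHessian (profile gbar C) i j u x
      = -(profileMatrix gbar C u i j + profileMatrix gbar C u j i) := by
  rw [spatialHessian, funext (profile_eq_sum hpos u), iteratedFDeriv_two_quadratic]

theorem laplacian_profile (hpos : ∀ r, (gbar r).PosDef) (u : ℝ) (x : EuclideanSpace ℝ (Fin m)) :
    Laplacian.laplacian (profile gbar C u) x = -2 * (profileMatrix gbar C u).trace := by
  rw [InnerProductSpace.laplacian_eq_iteratedFDeriv_orthonormalBasis _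
    (EuclideanSpace.basisFun (Fin m) ℝ), Matrix.trace, Finset.mul_sum]
  refine Finset.sum_congr rfl fun i _ => ?_
  have := spatialHessian_profile (C := C) hpos i i u x
  rw [spatialHessian] at this
  rw [EuclideanSpace.basisFun_apply, this, Matrix.diag_apply]
  ring

end ProfileHessian

/-! ### Curvature of Riemannian extensions along the axis -/

section Extensions

open Matrix

variable {m : ℕ}

/-- The point of the `r`-axis with parameter `r`. -/
def axis (r : ℝ) : Fin 1 ⊕ Fin m → ℝ := Sum.elim (fun _ => r) (fun _ => 0)

theorem deriv_comp_axis {f : (Fin 1 ⊕ Fin m → ℝ) → ℝ} (hf : ContDiff ℝ ∞ f) (r : ℝ) :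
    deriv (fun s => f (axis s)) r = partialD (Sum.inl 0) f (axis r) := by
  have h : HasDerivAt (axis (m := m)) (Pi.single (Sum.inl 0) 1) r := by
    refine hasDerivAt_pi.2 ?_
    rintro (a | i)
    · rw [Subsingleton.elim a 0, Pi.single_eq_same]
      exact hasDerivAt_id r
    · rw [Pi.single_eq_of_ne (by simp)]
      exact hasDerivAt_const r 0
  exact ((hf.differentiable (by simp) _).hasFDerivAt.comp_hasDerivAt r h).deriv

/-- The block form `(dr)² + γ_{ij} dxⁱ dxʲ` of a metric with a smooth family `γ`. -/
structure IsExtension (g : (Fin 1 ⊕ Fin m → ℝ) → Matrix (Fin 1 ⊕ Fin m) (Fin 1 ⊕ Fin m) ℝ)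
    (γ : (Fin 1 ⊕ Fin m → ℝ) → Matrix (Fin m) (Fin m) ℝ) : Prop where
  eq : ∀ p, g p = fromBlocks 1 0 0 (γ p)
  smooth : ∀ i j, ContDiff ℝ ∞ fun p => γ p i j
  posDef : ∀ p, (γ p).PosDef

variable {g : (Fin 1 ⊕ Fin m → ℝ) → Matrix (Fin 1 ⊕ Fin m) (Fin 1 ⊕ Fin m) ℝ}
  {γ : (Fin 1 ⊕ Fin m → ℝ) → Matrix (Fin m) (Fin m) ℝ}

theorem IsRiemannianMetric.isExtension (hg : IsRiemannianMetric g)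
    (h : ∀ p, g p = fromBlocks 1 0 0 (γ p)) : IsExtension g γ where
  eq := h
  smooth i j := by simpa [h] using hg.smooth (Sum.inr i) (Sum.inr j)
  posDef p := by
    have := (hg.posDef p).submatrix (e := Sum.inr) Sum.inr_injective
    rw [h] at this
    exact this

/-- The shape operator of the slices of constant `r`, at any point. -/
def sliceShapeOp (γ : (Fin 1 ⊕ Fin m → ℝ) → Matrix (Fin m) (Fin m) ℝ) (p : Fin 1 ⊕ Fin m → ℝ) :
    Matrix (Fin m) (Fin m) ℝ :=
  (1 / 2 : ℝ) • ((γ p)⁻¹ * of fun l i => partialD (Sum.inl 0) (fun q => γ q l i) p)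

/-- The Jacobi operator `Z ↦ R(Z, ∂_r) ∂_r` on the slices of constant `r`, at any point. -/
def sliceJacobiOp (γ : (Fin 1 ⊕ Fin m → ℝ) → Matrix (Fin m) (Fin m) ℝ) (p : Fin 1 ⊕ Fin m → ℝ) :
    Matrix (Fin m) (Fin m) ℝ :=
  -((of fun l i => partialD (Sum.inl 0) (fun q => sliceShapeOp γ q l i) p)
    + sliceShapeOp γ p * sliceShapeOp γ p)

namespace IsExtension

variable (h : IsExtension g γ)
include h

theorem inv_eq (p : Fin 1 ⊕ Fin m → ℝ) :
    (fromBlocks 1 0 0 (γ p) : Matrix (Fin 1 ⊕ Fin m) (Fin 1 ⊕ Fin m) ℝ)⁻¹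
      = fromBlocks 1 0 0 (γ p)⁻¹ := by
  refine inv_eq_left_inv ?_
  rw [fromBlocks_multiply]
  simp [nonsing_inv_mul _ ((isUnit_iff_isUnit_det _).1 (h.posDef p).isUnit)]

theorem symm (p : Fin 1 ⊕ Fin m → ℝ) (i j : Fin m) : γ p j i = γ p i j :=
  congrFun₂ (posDef_transpose_eq (h.posDef p)) i j

theorem christoffel_symm (k i j : Fin 1 ⊕ Fin m) : christoffel g k i j = christoffel g k j i := by
  funext p
  have hs : ∀ q, g q i j = g q j i := fun q => by
    have : (g q)ᵀ = g q := by
      rw [h.eq, fromBlocks_transpose, posDef_transpose_eq (h.posDef q)]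
      simp
    exact congrFun₂ this j i
  simp only [christoffel, hs]
  congr 1
  exact Finset.sum_congr rfl fun l _ => by ring

/-- The `r`-lines are geodesics, since g_rr is constant and the mixed components vanish. -/
theorem christoffel_rr (k : Fin 1 ⊕ Fin m) :
    christoffel g k (Sum.inl 0) (Sum.inl 0) = fun _ => 0 := by
  funext p
  obtain (k | k) := k <;> simp [christoffel, h.eq, partialD_const]

theorem christoffel_r_rx (i : Fin m) :
    christoffel g (Sum.inl 0) (Sum.inl 0) (Sum.inr i) = fun _ => 0 := by
  funext p
  simp [christoffel, h.inv_eq, h.eq, partialD_const]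

theorem christoffel_x_rx (l i : Fin m) :
    christoffel g (Sum.inr l) (Sum.inl 0) (Sum.inr i) = fun p => sliceShapeOp γ p l i := by
  funext p
  simp [christoffel, h.inv_eq, h.eq, partialD_const, sliceShapeOp, mul_apply, h.symm]

theorem contDiff_sliceShapeOp (l i : Fin m) : ContDiff ℝ ∞ fun p => sliceShapeOp γ p l i :=
  contDiff_const.mul (contDiff_matrix_mul
    (contDiff_matrix_inv h.smooth fun p => (h.posDef p).isUnit)
    (fun i j => contDiff_partialD _ (h.smooth i j)) l i)

theorem contDiff_sliceJacobiOp (l i : Fin m) : ContDiff ℝ ∞ fun p => sliceJacobiOp γ p l i :=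
  ((contDiff_partialD _ (h.contDiff_sliceShapeOp l i)).add
    (contDiff_matrix_mul h.contDiff_sliceShapeOp h.contDiff_sliceShapeOp l i)).neg

/-- As Γᵏ_rr = 0 and Γʳ_ri = 0, only -∂_r S - S² survives in R(∂_i, ∂_r)∂_r; no transverse
derivative of the metric enters. -/
theorem curvEndo_xrrx (i l : Fin m) :
    curvEndo g (Sum.inr i) (Sum.inl 0) (Sum.inl 0) (Sum.inr l)
      = fun p => sliceJacobiOp γ p l i := by
  funext p
  simp [curvEndo, h.christoffel_rr, h.christoffel_symm (i := Sum.inr i) (j := Sum.inl 0),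
    h.christoffel_r_rx, h.christoffel_x_rx, partialD_const, sliceJacobiOp, mul_apply]
  ring

theorem ricci_rr : ricci g (Sum.inl 0) (Sum.inl 0) = fun p => (sliceJacobiOp γ p).trace := by
  funext p
  simp only [ricci, Fintype.sum_sum_type, h.curvEndo_xrrx, trace, diag_apply]
  simp [curvEndo]

theorem riem_xrrx (i l : Fin m) :
    riem g (Sum.inr i) (Sum.inl 0) (Sum.inl 0) (Sum.inr l)
      = fun p => ((sliceJacobiOp γ p)ᵀ * γ p) i l := by
  funext p
  simp only [riem, Fintype.sum_sum_type, h.curvEndo_xrrx, mul_apply, transpose_apply]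
  simp [h.eq]

theorem covDerivRicci_rrr (p : Fin 1 ⊕ Fin m → ℝ) :
    covDerivRicci g (Sum.inl 0) (Sum.inl 0) (Sum.inl 0) p
      = partialD (Sum.inl 0) (fun q => (sliceJacobiOp γ q).trace) p := by
  simp [covDerivRicci, h.christoffel_rr, h.ricci_rr]

/-- The corrections in the two ∂_r slots vanish because Γᵏ_rr = 0; those in the outer slots act
through S. -/
theorem covDerivRiem_rxrrx (i l : Fin m) (p : Fin 1 ⊕ Fin m → ℝ) :
    covDerivRiem g (Sum.inl 0) (Sum.inr i) (Sum.inl 0) (Sum.inl 0) (Sum.inr l) p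
      = partialD (Sum.inl 0) (fun q => ((sliceJacobiOp γ q)ᵀ * γ q) i l) p
        - ((sliceShapeOp γ p)ᵀ * ((sliceJacobiOp γ p)ᵀ * γ p)
          + (sliceJacobiOp γ p)ᵀ * γ p * sliceShapeOp γ p) i l := by
  simp only [covDerivRiem, h.christoffel_rr, Fintype.sum_sum_type, Fin.sum_univ_one,
    h.christoffel_r_rx, h.christoffel_x_rx, h.riem_xrrx]
  rw [Matrix.add_apply, mul_apply (M := (sliceShapeOp γ p)ᵀ),
    mul_apply (N := sliceShapeOp γ p), ← Finset.sum_add_distrib]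
  simp only [zero_mul, add_zero, zero_add, transpose_apply]
  congr 1
  exact Finset.sum_congr rfl fun k _ => by ring

variable {gbar : ℝ → Matrix (Fin m) (Fin m) ℝ} (haxis : ∀ r, γ (axis r) = gbar r)
include haxis

theorem sliceShapeOp_axis (r : ℝ) : sliceShapeOp γ (axis r) = shapeOp gbar r := by
  have : (of fun l i => partialD (Sum.inl 0) (fun q => γ q l i) (axis r)) = matDeriv gbar r := by
    ext l i
    simp only [of_apply, matDeriv, ← haxis]
    exact (deriv_comp_axis (h.smooth l i) r).symm
  rw [sliceShapeOp, this, haxis, shapeOp]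

/-- All derivatives involved are along the axis, where γ is ḡ, so values off the axis are
irrelevant. This makes the obstructions uniform over all extensions. -/
theorem sliceJacobiOp_axis (r : ℝ) : sliceJacobiOp γ (axis r) = jacobiOp gbar r := by
  have : (of fun l i => partialD (Sum.inl 0) (fun q => sliceShapeOp γ q l i) (axis r))
      = matDeriv (shapeOp gbar) r := by
    ext l i
    simp only [of_apply, matDeriv, ← h.sliceShapeOp_axis haxis]
    exact (deriv_comp_axis (h.contDiff_sliceShapeOp l i) r).symm
  rw [sliceJacobiOp, this, h.sliceShapeOp_axis haxis, jacobiOp]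

theorem trace_jacobiOp_eq_zero (hflat : RicciFlat g) (r : ℝ) : (jacobiOp gbar r).trace = 0 := by
  rw [← h.sliceJacobiOp_axis haxis, ← hflat (Sum.inl 0) (Sum.inl 0) (axis r), h.ricci_rr]

theorem deriv_trace_jacobiOp_eq_zero (hpar : ParallelRicci g) (r : ℝ) :
    deriv (fun s => (jacobiOp gbar s).trace) r = 0 := by
  have hK : ContDiff ℝ ∞ fun q => (sliceJacobiOp γ q).trace :=
    ContDiff.sum fun i _ => h.contDiff_sliceJacobiOp i i
  simp only [← h.sliceJacobiOp_axis haxis]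
  rw [deriv_comp_axis hK, ← h.covDerivRicci_rrr, hpar]

theorem matDeriv_jacobiForm (hsym : LocallySymmetric g) (r : ℝ) :
    matDeriv (fun s => (jacobiOp gbar s)ᵀ * gbar s) r
      = (shapeOp gbar r)ᵀ * ((jacobiOp gbar r)ᵀ * gbar r)
        + (jacobiOp gbar r)ᵀ * gbar r * shapeOp gbar r := by
  ext i l
  have hW : ContDiff ℝ ∞ fun q => ((sliceJacobiOp γ q)ᵀ * γ q) i l :=
    contDiff_matrix_mul (fun i j => h.contDiff_sliceJacobiOp j i) h.smooth i l
  have h1 := hsym (Sum.inl 0) (Sum.inr i) (Sum.inl 0) (Sum.inl 0) (Sum.inr l) (axis r)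
  rw [h.covDerivRiem_rxrrx, ← deriv_comp_axis hW, sub_eq_zero] at h1
  simp only [h.sliceShapeOp_axis haxis, h.sliceJacobiOp_axis haxis, haxis] at h1
  exact h1

/-- With W = Kᵀḡ one has Nᵀ = CᵀWC. Local symmetry gives W' = SᵀW + WS, and these two terms cancel
against those produced by C' = -SC. Working with Nᵀ avoids having to prove that ḡK is symmetric. -/
theorem matDeriv_profileMatrix_eq_zero (hsym : LocallySymmetric g)
    (hsmooth : ∀ i j, ContDiff ℝ ∞ fun r => gbar r i j) (hpos : ∀ r, (gbar r).PosDef)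
    {C : ℝ → Matrix (Fin m) (Fin m) ℝ} (hC : IsBrinkmannFrame gbar C) (u : ℝ) :
    matDeriv (profileMatrix gbar C) u = 0 := by
  have hCT : ∀ i j, ContDiff ℝ ∞ fun u => (C u)ᵀ i j := fun i j => hC.smooth j i
  have hB := contDiff_shapeOp hsmooth hpos
  have hK : ∀ i j, ContDiff ℝ ∞ fun u => jacobiOp gbar u i j := fun i j =>
    ((contDiff_matDeriv hB i j).add (contDiff_matrix_mul hB hB i j)).neg
  have hW : ∀ i j, ContDiff ℝ ∞ fun u => ((jacobiOp gbar u)ᵀ * gbar u) i j :=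
    contDiff_matrix_mul (fun i j => hK j i) hsmooth
  have h1 : (fun u => (profileMatrix gbar C u)ᵀ)
      = fun u => (C u)ᵀ * ((jacobiOp gbar u)ᵀ * gbar u) * C u := funext fun u => by
    rw [hC.profileMatrix_eq hsmooth hpos]
    simp [transpose_mul, posDef_transpose_eq (hpos u), Matrix.mul_assoc]
  rw [← transpose_eq_zero, ← matDeriv_transpose, h1,
    matDeriv_mul (contDiff_matrix_mul hCT hW) hC.smooth, matDeriv_mul hCT hW,
    matDeriv_transpose, h.matDeriv_jacobiForm haxis hsym, hC.matDeriv_eq hsmooth hpos]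
  simp only [transpose_neg, transpose_mul, Matrix.add_mul, Matrix.mul_add, Matrix.mul_assoc,
    Matrix.neg_mul, Matrix.mul_neg]
  abel

end IsExtension

end Extensions

/-! ### Obstructions to parallel Ricci, Ricci-flat and locally symmetric extensions -/

theorem exists_isExtension {m : ℕ} {gbar : ℝ → Matrix (Fin m) (Fin m) ℝ}
    {g : (Fin 1 ⊕ Fin m → ℝ) → Matrix (Fin 1 ⊕ Fin m) (Fin 1 ⊕ Fin m) ℝ}
    (hg : g ∈ riemannianExtensions gbar) :
    ∃ γ, IsExtension g γ ∧ ∀ r, γ (axis r) = gbar r := by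
  obtain ⟨hg, γ, hγ, haxis⟩ := hg
  exact ⟨γ, hg.isExtension hγ, haxis⟩

end PlaneWave
end

theorem theorem1 {m : ℕ} (gbar : ℝ → Matrix (Fin m) (Fin m) ℝ)
    (hsmooth : ∀ i j, ContDiff ℝ ∞ fun r => gbar r i j)
    (hpos : ∀ r, (gbar r).PosDef) :
    (∃ C, PlaneWave.IsBrinkmannFrame gbar C) ∧
    ∀ C, PlaneWave.IsBrinkmannFrame gbar C →
      (PlaneWave.IsSmoothDiffeo (PlaneWave.brinkmannToRosen gbar C) ∧
        PlaneWave.pullbackMetric (PlaneWave.brinkmannToRosen gbar C) (PlaneWave.planeWave gbar) =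
          PlaneWave.brinkmannMetric (PlaneWave.profile gbar C)) ∧
      ((∃ u x, deriv (fun s => Laplacian.laplacian (PlaneWave.profile gbar C s) x) u ≠ 0) →
        ∀ g ∈ PlaneWave.riemannianExtensions gbar, ¬ PlaneWave.ParallelRicci g) ∧
      ((∃ u x, Laplacian.laplacian (PlaneWave.profile gbar C u) x ≠ 0) →
        ∀ g ∈ PlaneWave.riemannianExtensions gbar, ¬ PlaneWave.RicciFlat g) ∧
      ((∃ i j u x, deriv (fun s => PlaneWave.spatialHessian (PlaneWave.profile gbar C) i j s x) u
          ≠ 0) →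
        ∀ g ∈ PlaneWave.riemannianExtensions gbar, ¬ PlaneWave.LocallySymmetric g) := by
  open PlaneWave in
  refine ⟨exists_isBrinkmannFrame hsmooth hpos, fun C hC => ⟨⟨hC.isSmoothDiffeo_brinkmannToRosen
    hsmooth, hC.pullbackMetric_brinkmannToRosen hsmooth hpos⟩, ?_, ?_, ?_⟩⟩
  · rintro ⟨u, x, hu⟩ g hg hpar
    obtain ⟨γ, h, haxis⟩ := exists_isExtension hg
    refine hu ?_
    simp only [laplacian_profile hpos, hC.trace_profileMatrix hsmooth hpos]
    rw [deriv_const_mul_field, h.deriv_trace_jacobiOp_eq_zero haxis hpar, mul_zero]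
  · rintro ⟨u, x, hu⟩ g hg hflat
    obtain ⟨γ, h, haxis⟩ := exists_isExtension hg
    refine hu ?_
    rw [laplacian_profile hpos, hC.trace_profileMatrix hsmooth hpos,
      h.trace_jacobiOp_eq_zero haxis hflat, mul_zero]
  · rintro ⟨i, j, u, x, hu⟩ g hg hsym
    obtain ⟨γ, h, haxis⟩ := exists_isExtension hg
    refine hu ?_
    have hN : ∀ i j, deriv (fun s => profileMatrix gbar C s i j) u = 0 := fun i j =>
      congrFun₂ (h.matDeriv_profileMatrix_eq_zero haxis hsym hsmooth hpos hC u) i j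
    have hC' := contDiff_matDeriv hC.smooth
    -- The Hessian is -(N_ij + N_ji), so splitting its derivative requires both entries to be
    -- differentiable; a vanishing `deriv` alone would not give this.
    have hd : ∀ i j, DifferentiableAt ℝ (fun s => profileMatrix gbar C s i j) u := fun i j =>
      (contDiff_matrix_mul (A := fun s => (matDeriv (fun s => gbar s * matDeriv C s) s).transpose)
        (fun i j => contDiff_matDeriv (contDiff_matrix_mul hsmooth hC') j i) hC.smooth i j).differentiable
        (by simp) u
    simp only [spatialHessian_profile hpos]
    rw [deriv.fun_neg, deriv_fun_add (hd i j) (hd j i), hN, hN, add_zero, neg_zero]
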